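/- For a topological space $T$ let $C(T)$ be the ring of continuous real-valued functions on $T$. A row $v\in C(T)^n$ is unimodular if $\sum_i v_ib_i=1$ for some $b\in C(T)^n$. For unimodular rows $v,w\in C(T)^n$ write $v\sim w$ if $v\alpha=w$ for some $\alpha\in GL_n(C(T))$. A row is completable over $C(T)$ if it is the first row of a matrix in $GL_n(C(T))$. A continuous map $f:T\to S^{n-1}\subset\mathbb R^n$ is identified with the row of its $n$ coordinate functions in $C(T)^n$. For $0\ne u\in\mathbb R^n$ let $\sigma_u$ be the reflection $x\mapsto x-2\frac{\langle x,u\rangle}{\langle u,u\rangle}u$. Let $(x,y,z)\in C(S^2)^3$ be the row of coordinate functions of $S^2\subset\mathbb R^3$, i.e. the row of the identity map. Then: 1. Let $T$ be a compact Hausdorff space and let $H:T\times[0,1]\to S^{n-1}$ be continuous, with stages $v_t=H(\cdot,t)$. There are $0=t_0\le t_1\le\dots\le t_N=1$ and $\alpha_0,\dots,\alpha_{N-1}\in GL_n(C(T))$ such that for all $i$ and all $p\in T$ one has $v_{t_i}(p)+v_{t_{i+1}}(p)\neq 0$, $\alpha_i(p)$ is the matrix of $-\sigma_{v_{t_i}(p)+v_{t_{i+1}}(p)}$,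 and $v_{t_i}\alpha_i=v_{t_{i+1}}$. Moreover $v_0$ and $v_1$ are unimodular and $v_0\sim v_1$. 2. In particular, a homotopy of maps $S^2\to S^2$ from the constant map $(1,0,0)$ to the identity would give such a chain of $GL_3(C(S^2))$-equivalences from $(1,0,0)$ to $(x,y,z)$, so that $(1,0,0)\sim(x,y,z)$ and $(x,y,z)$ would be completable over $C(S^2)$. 3. If there is no nowhere vanishing continuous tangent vector field on $S^2$, then $(x,y,z)$ is not completable over $C(S^2)$. 4. If $(x,y,z)$ is not completable over $C(S^2)$, then $S^2$ is not contractible. 5. Consequently (by the hairy ball theorem), $(x,y,z)$ is not completable over $C(S^2)$, and $S^2$ is not contractible. -/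

import Mathlib

open scoped Matrix unitInterval

noncomputable section

namespace SphereRows

/-- The unit sphere `S^{n-1}` of Euclidean space `ℝ^n`. -/
abbrev UnitSphere (n : ℕ) : Type :=
  Metric.sphere (0 : EuclideanSpace ℝ (Fin n)) 1

/-- A row `a ∈ A^n` is unimodular if `∑ i, a i * b i = 1` for some `b ∈ A^n`. -/
def IsUnimodular {n : ℕ} {A : Type*} [CommRing A] (a : Fin n → A) : Prop :=
  ∃ b : Fin n → A, ∑ i, a i * b i = 1

/-- `GL_n(A)`-equivalence of unimodular rows: `v α = w` for some `α ∈ GL_n(A)`. -/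
def GLEquiv {n : ℕ} {A : Type*} [CommRing A] (v w : Fin n → A) : Prop :=
  IsUnimodular v ∧ IsUnimodular w ∧
    ∃ α : GL (Fin n) A, v ᵥ* (α : Matrix (Fin n) (Fin n) A) = w

/-- A row is completable if it is the first row of a matrix in `GL_n(A)`. -/
def IsCompletable {n : ℕ} [NeZero n] {A : Type*} [CommRing A] (v : Fin n → A) : Prop :=
  ∃ α : GL (Fin n) A, (α : Matrix (Fin n) (Fin n) A) 0 = v

/-- The row over `C(T)` formed by the coordinate functions of a map `T → S^{n-1}`. -/
def rowOf {n : ℕ} {T : Type*} [TopologicalSpace T] (f : C(T, UnitSphere n)) :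
    Fin n → C(T, ℝ) :=
  fun i => ⟨fun p => (f p : EuclideanSpace ℝ (Fin n)) i, by fun_prop⟩

/-- `α ∈ GL_n(C(T))` is, at every point `p`, the matrix of `-σ_{v(p) + w(p)}`, where `σ_u` is the
reflection with `σ_u u = -u` that fixes the hyperplane orthogonal to `u`, and `v(p)`, `w(p)` are
nowhere antipodal. Matrices act on rows from the right. -/
def IsNegReflection {n : ℕ} {T : Type*} [TopologicalSpace T] (v w : C(T, UnitSphere n))
    (α : GL (Fin n) C(T, ℝ)) : Prop :=
  ∀ p : T, (v p : EuclideanSpace ℝ (Fin n)) + w p ≠ 0 ∧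
    ∀ x : EuclideanSpace ℝ (Fin n),
      WithLp.toLp 2 (x.ofLp ᵥ* ((α : Matrix (Fin n) (Fin n) C(T, ℝ)).map fun a => a p)) =
        -(ℝ ∙ ((v p : EuclideanSpace ℝ (Fin n)) + w p))ᗮ.reflection x

/-- Along the homotopy `H` from `f` to `g`, with stages `H_t`, there are times
`0 = t_0 ≤ t_1 ≤ … ≤ t_N = 1` and matrices `α_i ∈ GL_n(C(T))` carrying the row of `H_{t_i}` to the
row of `H_{t_{i+1}}`, each given pointwise by the negative of a reflection. -/
def HasReflectionChain {n : ℕ} {T : Type*} [TopologicalSpace T] {f g : C(T, UnitSphere n)}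
    (H : f.Homotopy g) : Prop :=
  ∃ (N : ℕ) (t : Fin (N + 1) → I) (α : Fin N → GL (Fin n) C(T, ℝ)),
    t 0 = 0 ∧ t (Fin.last N) = 1 ∧ Monotone t ∧
    ∀ i : Fin N,
      IsNegReflection (H.curry (t i.castSucc)) (H.curry (t i.succ)) (α i) ∧
      rowOf (H.curry (t i.castSucc)) ᵥ* (α i : Matrix (Fin n) (Fin n) C(T, ℝ)) =
        rowOf (H.curry (t i.succ))

/-- The point `(1, 0, 0)` of `S²`. -/
def basePoint : UnitSphere 3 :=
  ⟨EuclideanSpace.single 0 1, by simp⟩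

/-- The row `(x, y, z)` of coordinate functions over `C(S²)`. -/
def xyz : Fin 3 → C(UnitSphere 3, ℝ) :=
  rowOf (ContinuousMap.id (UnitSphere 3))

/-- There is a nowhere vanishing continuous tangent vector field on `S²`. -/
def HasNonvanishingTangentField : Prop :=
  ∃ X : C(UnitSphere 3, EuclideanSpace ℝ (Fin 3)),
    ∀ p : UnitSphere 3, inner ℝ (p : EuclideanSpace ℝ (Fin 3)) (X p) = 0 ∧ X p ≠ 0

end SphereRows

end

open scoped Matrix unitInterval

noncomputable section

namespace SphereRows

/-! Nearby stages of a homotopy are never antipodal, and for unit vectors `v`, `w` with `v + w ≠ 0`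
the map `-σ_{v+w}` sends `v` to `w`; uniform continuity in time therefore gives a finite chain of
reflections (`hasReflectionChain`). Contractibility would thus make `xyz` completable, and
projecting the second row of a completion to the tangent planes would give a nowhere vanishing
field. Such a field is excluded by a winding number argument: read in stereographic coordinates on
the two hemispheres it gives functions with continuous logarithms, and comparing them on the equator
yields a logarithm of `-w ^ 2`, which has winding number 2. -/

/-! ### The hairy ball theorem -/

open Complex in
theorem not_exists_log_neg_sq (a : C(ℂ, ℂ)) (ha : ∀ w : ℂ, ‖w‖ = 1 → exp (a w) = -w ^ 2) :
    False := by
  let g : ℝ → ℂ := fun θ => a (exp (θ * Complex.I)) - 2 * (θ * Complex.I)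
  have hg : Continuous g := by fun_prop
  have hexp (θ : ℝ) : exp (g θ) = -1 := by
    have h : exp (2 * (θ * Complex.I)) = exp (θ * Complex.I) ^ 2 := by rw [← exp_nat_mul]; norm_num
    rw [exp_sub, ha _ (norm_exp_ofReal_mul_I θ), h, neg_div,
      div_self (pow_ne_zero 2 (exp_ne_zero _))]
  -- `g` lifts the constant `-1` through `exp`, so it is constant; but `a` has equal values at
  -- angles `0` and `2π`, while `2θi` grows by `4πi`.
  have hconst := isCoveringMap_exp.const_of_comp hg
    (fun x y => Subtype.ext ((hexp x).trans (hexp y).symm)) (2 * Real.pi) 0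
  simp [g, exp_two_pi_mul_I] at hconst

theorem exists_log (f : C(ℂ, ℂ)) (hf : ∀ w, f w ≠ 0) :
    ∃ a : C(ℂ, ℂ), ∀ w, Complex.exp (a w) = f w := by
  obtain ⟨a, ⟨-, ha⟩, -⟩ := Complex.isCoveringMapOn_exp.existsUnique_continuousMap_lifts f
    (a₀ := 0) (Complex.exp_log (hf 0)) hf
  exact ⟨a, congrFun ha⟩

/-- The radial retraction of the plane onto the closed unit disc. -/
def discRetraction (w : ℂ) : ℂ := (max 1 ‖w‖)⁻¹ • w

theorem continuous_discRetraction : Continuous discRetraction :=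
  ((continuous_const.max continuous_norm).inv₀ fun w => by positivity).smul continuous_id

theorem norm_discRetraction_le (w : ℂ) : ‖discRetraction w‖ ≤ 1 := by
  have : (0 : ℝ) < max 1 ‖w‖ := by positivity
  rw [discRetraction, norm_smul, norm_inv, Real.norm_of_nonneg this.le, inv_mul_le_one₀ this]
  exact le_max_right _ _

theorem discRetraction_of_norm_eq_one {w : ℂ} (hw : ‖w‖ = 1) : discRetraction w = w := by
  simp [discRetraction, hw]

/-- The height above the disc of the upper hemisphere, over the radial retraction of `w`. -/
def discHeight (w : ℂ) : ℝ := √(1 - ‖discRetraction w‖ ^ 2)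

theorem continuous_discHeight : Continuous discHeight :=
  ((continuous_const.sub (continuous_discRetraction.norm.pow 2))).sqrt

theorem discHeight_sq (w : ℂ) : discHeight w ^ 2 =
    1 - ((discRetraction w).re ^ 2 + (discRetraction w).im ^ 2) := by
  have := norm_discRetraction_le w
  rw [discHeight, Real.sq_sqrt (by nlinarith [norm_nonneg (discRetraction w)]), Complex.sq_norm,
    Complex.normSq_apply]
  ring

theorem discHeight_of_norm_eq_one {w : ℂ} (hw : ‖w‖ = 1) : discHeight w = 0 := by
  simp [discHeight, discRetraction_of_norm_eq_one hw, hw]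

/-- The point of the upper (`s = 1`) or lower (`s = -1`) hemisphere over the radial retraction of
`w` to the disc. -/
def hemisphere (s : ℝ) (hs : s ^ 2 = 1) : C(ℂ, UnitSphere 3) where
  toFun w := ⟨!₂[(discRetraction w).re, (discRetraction w).im, s * discHeight w], by
    rw [mem_sphere_zero_iff_norm, EuclideanSpace.norm_eq, Real.sqrt_eq_one]
    simp only [Fin.sum_univ_three, Real.norm_eq_abs, sq_abs]
    simp [mul_pow, hs, discHeight_sq]⟩
  continuous_toFun := by
    have h1 := continuous_discRetraction
    have h2 := continuous_discHeight
    refine Continuous.subtype_mk ((PiLp.continuous_toLp 2 _).comp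
      (continuous_pi fun i => ?_)) _
    fin_cases i
    · exact Complex.continuous_re.comp h1
    · exact Complex.continuous_im.comp h1
    · exact continuous_const.mul h2

theorem hemisphere_of_norm_eq_one {s t : ℝ} (hs : s ^ 2 = 1) (ht : t ^ 2 = 1) {w : ℂ}
    (hw : ‖w‖ = 1) : hemisphere s hs w = hemisphere t ht w := by
  simp [hemisphere, discHeight_of_norm_eq_one hw]

/-- Up to the factor `(1 + c)⁻²`, the differential of `(x, y, z) ↦ (x, y) / (1 + z)` at `(a, b, c)`
is `((1 + c) x - a z, (1 + c) y - b z)`; it is injective on the tangent plane. -/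
theorem stereographic_derivative_injective {a b c x y z : ℝ} (hc : 0 < 1 + c)
    (h : a ^ 2 + b ^ 2 + c ^ 2 = 1) (ht : a * x + b * y + c * z = 0)
    (hx : (1 + c) * x = a * z) (hy : (1 + c) * y = b * z) : x = 0 ∧ y = 0 ∧ z = 0 := by
  have hz : (1 + c) * z = 0 := by linear_combination (1 + c) * ht - a * hx - b * hy - z * h
  have hz : z = 0 := by simpa [hc.ne'] using hz
  subst hz
  simpa [hc.ne'] using And.intro hx hy

theorem inner_eq_three (u v : EuclideanSpace ℝ (Fin 3)) :
    inner ℝ u v = u 0 * v 0 + u 1 * v 1 + u 2 * v 2 := by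
  simp [PiLp.inner_apply, Fin.sum_univ_three, mul_comm]

/-- In stereographic coordinates, a nowhere vanishing tangent field on a closed hemisphere has a
continuous logarithm. -/
theorem exists_log_on_hemisphere (X : C(UnitSphere 3, EuclideanSpace ℝ (Fin 3)))
    (hX : ∀ p : UnitSphere 3, inner ℝ (p : EuclideanSpace ℝ (Fin 3)) (X p) = 0 ∧ X p ≠ 0)
    (s : ℝ) (hs : s ^ 2 = 1) :
    ∃ a : C(ℂ, ℂ), ∀ w : ℂ, ‖w‖ = 1 → Complex.exp (a w) =
      (X (hemisphere s hs w) 0 + X (hemisphere s hs w) 1 * Complex.I) -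
        s * w * X (hemisphere s hs w) 2 := by
  have h1 := continuous_discRetraction
  have h2 := continuous_discHeight
  let f : C(ℂ, ℂ) := ⟨fun w => (1 + discHeight w : ℝ) *
    (X (hemisphere s hs w) 0 + X (hemisphere s hs w) 1 * Complex.I) -
      s * discRetraction w * X (hemisphere s hs w) 2, by fun_prop⟩
  have hf (w : ℂ) : f w ≠ 0 := by
    intro h0
    obtain ⟨ht, hne⟩ := hX (hemisphere s hs w)
    set v := X (hemisphere s hs w) with hv
    have ht' : (discRetraction w).re * v 0 + (discRetraction w).im * v 1 +
        discHeight w * (s * v 2) = 0 := by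
      rw [← ht, inner_eq_three]
      simp [hemisphere]
      ring
    have h0' : (1 + discHeight w : ℝ) * (v 0 + v 1 * Complex.I) -
      s * discRetraction w * v 2 = 0 := h0
    have hre := congrArg Complex.re h0'
    have him := congrArg Complex.im h0'
    simp at hre him
    obtain ⟨hx, hy, hz⟩ := stereographic_derivative_injective
      (c := discHeight w) (x := v 0) (y := v 1)
      (by have : 0 ≤ discHeight w := Real.sqrt_nonneg _
          linarith) (by rw [discHeight_sq]; ring) ht'
      (by linear_combination hre) (by linear_combination him)
    have hs0 : s ≠ 0 := by rintro rfl; norm_num at hs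
    apply hne
    ext i
    fin_cases i
    · exact hx
    · exact hy
    · simpa [hs0] using hz
  obtain ⟨a, ha⟩ := exists_log f hf
  refine ⟨a, fun w hw => ?_⟩
  rw [ha]
  simp [f, discHeight_of_norm_eq_one hw, discRetraction_of_norm_eq_one hw]

/-- The hairy ball theorem for the two-dimensional sphere. -/
theorem not_hasNonvanishingTangentField : ¬ HasNonvanishingTangentField := by
  rintro ⟨X, hX⟩
  obtain ⟨a, ha⟩ := exists_log_on_hemisphere X hX 1 (by norm_num)
  obtain ⟨b, hb⟩ := exists_log_on_hemisphere X hX (-1) (by norm_num)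
  -- On the equator the two functions are `V - w X₂` and `V + w X₂`, with `V = X₀ + i X₁`; the first
  -- is `-w ^ 2` times the conjugate of the second.
  refine not_exists_log_neg_sq ⟨fun w => a w - (starRingEnd ℂ) (b w), by fun_prop⟩ fun w hw => ?_
  have hmul : (starRingEnd ℂ) w * w = 1 := by
    rw [mul_comm, Complex.mul_conj, Complex.normSq_eq_norm_sq, hw]; norm_num
  have hbw := hb w hw
  rw [hemisphere_of_norm_eq_one _ (one_pow 2) hw] at hbw
  obtain ⟨ht, -⟩ := hX (hemisphere 1 (one_pow 2) w)
  have ht' : w.re * X (hemisphere 1 (one_pow 2) w) 0 +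
      w.im * X (hemisphere 1 (one_pow 2) w) 1 = 0 := by
    rw [← ht, inner_eq_three]
    simp [hemisphere, discHeight_of_norm_eq_one hw, discRetraction_of_norm_eq_one hw]
  have haw := ha w hw
  generalize X (hemisphere 1 (one_pow 2) w) = v at haw hbw ht'
  -- Tangency on the equator says `Re (V * conj w) = 0`; multiply by `w` and use `conj w * w = 1`.
  have key : (v 0 + v 1 * Complex.I : ℂ) = -w ^ 2 * (v 0 - v 1 * Complex.I) := by
    have h : (v 0 + v 1 * Complex.I : ℂ) * (starRingEnd ℂ) w + w * (v 0 - v 1 * Complex.I) =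
        2 * (w.re * v 0 + w.im * v 1 : ℝ) := by
      apply Complex.ext <;> simp <;> ring
    rw [ht', Complex.ofReal_zero] at h
    linear_combination w * h - (v 0 + v 1 * Complex.I) * hmul
  rw [ContinuousMap.coe_mk, Complex.exp_sub, div_eq_iff (Complex.exp_ne_zero _), Complex.exp_conj,
    haw, hbw]
  simp
  linear_combination key + w * v 2 * hmul

/-! ### Equivalence of rows -/

section GLEquiv

variable {n : ℕ} {A : Type*} [CommRing A]

theorem GLEquiv.refl {v : Fin n → A} (hv : IsUnimodular v) : GLEquiv v v :=
  ⟨hv, hv, 1, by simp⟩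

theorem GLEquiv.trans {u v w : Fin n → A} (h₁ : GLEquiv u v) (h₂ : GLEquiv v w) :
    GLEquiv u w := by
  obtain ⟨hu, -, α, rfl⟩ := h₁
  obtain ⟨-, hw, β, rfl⟩ := h₂
  exact ⟨hu, hw, α * β, by simp [Matrix.vecMul_vecMul]⟩

theorem GLEquiv.isCompletable [NeZero n] {w : Fin n → A} (h : GLEquiv (Pi.single 0 1) w) :
    IsCompletable w := by
  obtain ⟨-, -, α, h⟩ := h
  exact ⟨α, by simpa [Matrix.row] using h⟩

end GLEquiv

/-! ### Reflections and homotopies -/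

variable {n : ℕ} {T : Type*} [TopologicalSpace T]

theorem sum_sq_eq_one (p : UnitSphere n) : ∑ i, p.1 i * p.1 i = 1 := by
  have h := EuclideanSpace.real_norm_sq_eq p.1
  rw [norm_eq_of_mem_sphere p] at h
  simpa [sq] using h.symm

theorem isUnimodular_rowOf (f : C(T, UnitSphere n)) : IsUnimodular (rowOf f) := by
  refine ⟨rowOf f, ContinuousMap.ext fun p => ?_⟩
  simpa [rowOf] using sum_sq_eq_one (f p)

theorem eval_vecMul (a : Fin n → C(T, ℝ)) (M : Matrix (Fin n) (Fin n) C(T, ℝ)) (p : T)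
    (j : Fin n) : (a ᵥ* M) j p = ((fun i => a i p) ᵥ* M.map fun a => a p) j := by
  simp [Matrix.vecMul, dotProduct]

/-- The matrix of `-σ_u` for a vector `u` of continuous functions, where `c = 2 / ⟨u, u⟩`. -/
def negReflectionMatrix {A : Type*} [CommRing A] (u : Fin n → A) (c : A) :
    Matrix (Fin n) (Fin n) A :=
  c • Matrix.vecMulVec u u - 1

theorem negReflectionMatrix_mul_self {A : Type*} [CommRing A] {u : Fin n → A} {c : A}
    (h : c * (u ⬝ᵥ u) = 2) : negReflectionMatrix u c * negReflectionMatrix u c = 1 := by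
  have : c • c • (u ⬝ᵥ u) • Matrix.vecMulVec u u = (2 * c) • Matrix.vecMulVec u u := by
    rw [smul_smul, smul_smul, ← h]; congr 1; ring
  simp only [negReflectionMatrix, sub_mul, mul_sub, Matrix.smul_mul, Matrix.mul_smul,
    Matrix.vecMulVec_mul_vecMulVec, one_mul, mul_one, Matrix.vecMulVec_smul, this]
  rw [two_mul, add_smul]
  abel

theorem exists_isNegReflection (v w : C(T, UnitSphere n))
    (h : ∀ p, (v p : EuclideanSpace ℝ (Fin n)) + w p ≠ 0) :
    ∃ α : GL (Fin n) C(T, ℝ), IsNegReflection v w α := by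
  let u : Fin n → C(T, ℝ) := rowOf v + rowOf w
  let c : C(T, ℝ) := ⟨fun p => 2 / ‖(v p : EuclideanSpace ℝ (Fin n)) + w p‖ ^ 2, by
    refine continuous_const.div (by fun_prop) fun p => ?_
    have := h p
    positivity⟩
  have hu (p : T) : ∑ i, u i p * u i p = ‖(v p : EuclideanSpace ℝ (Fin n)) + w p‖ ^ 2 := by
    rw [EuclideanSpace.real_norm_sq_eq]
    simp [u, rowOf, sq]
  have hc : c * (u ⬝ᵥ u) = 2 := by
    ext p
    have := h p
    have hn : ‖(v p : EuclideanSpace ℝ (Fin n)) + w p‖ ^ 2 ≠ 0 := by positivity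
    simp only [dotProduct, ContinuousMap.mul_apply, ContinuousMap.sum_apply, hu]
    exact div_mul_cancel₀ _ hn
  refine ⟨⟨negReflectionMatrix u c, negReflectionMatrix u c, negReflectionMatrix_mul_self hc,
    negReflectionMatrix_mul_self hc⟩, fun p => ⟨h p, fun x => ?_⟩⟩
  -- `-σ_u` is the reflection in the line spanned by `u`, `x ↦ 2⟨u, x⟩/⟨u, u⟩ u - x`. Its matrix is
  -- symmetric, so acting on rows or columns is the same.
  rw [Submodule.reflection_orthogonal_apply, neg_neg, Submodule.reflection_singleton_apply]
  have hM : (negReflectionMatrix u c).map (fun a => a p) =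
      negReflectionMatrix (fun i => u i p) (c p) := by
    ext i j
    by_cases hij : i = j <;> simp [negReflectionMatrix, Matrix.vecMulVec_apply, hij]
  ext j
  change (x.ofLp ᵥ* (negReflectionMatrix u c).map fun a => a p) j = _
  rw [hM]
  simp only [negReflectionMatrix, Matrix.vecMul_sub, Matrix.vecMul_one, Matrix.vecMul_smul,
    Matrix.vecMul_vecMulVec]
  simp [u, c, rowOf, PiLp.inner_apply, dotProduct]
  ring

theorem IsNegReflection.rowOf_vecMul {v w : C(T, UnitSphere n)} {α : GL (Fin n) C(T, ℝ)}
    (h : IsNegReflection v w α) :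
    rowOf v ᵥ* (α : Matrix (Fin n) (Fin n) C(T, ℝ)) = rowOf w := by
  ext j p
  have hr := (h p).2 (v p)
  -- For vectors of equal norm, `σ_{a-b}` sends `a` to `b`; take `a = v p` and `b = -w p`.
  have hs := Submodule.reflection_sub (v := (v p : EuclideanSpace ℝ (Fin n))) (w := -(w p).1)
    (by rw [norm_neg, norm_eq_of_mem_sphere, norm_eq_of_mem_sphere])
  rw [sub_neg_eq_add] at hs
  rw [hs, neg_neg] at hr
  rw [eval_vecMul]
  exact congrFun (congrArg WithLp.ofLp hr) j

theorem add_ne_zero_of_dist_lt_two {p q : UnitSphere n} (h : dist p q < 2) :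
    (p : EuclideanSpace ℝ (Fin n)) + q ≠ 0 := by
  intro h0
  rw [Subtype.dist_eq, eq_neg_of_add_eq_zero_right h0, dist_eq_norm, sub_neg_eq_add, ← two_smul ℝ,
    norm_smul, norm_eq_of_mem_sphere] at h
  norm_num at h

theorem hasReflectionChain [CompactSpace T] {f g : C(T, UnitSphere n)} (H : f.Homotopy g) :
    HasReflectionChain H := by
  -- The bound `2` is the distance between antipodal points; times are spaced by `1 / (m + 1) < δ`.
  obtain ⟨δ, hδ, hH⟩ := Metric.uniformContinuous_iff.1
    (CompactSpace.uniformContinuous_of_continuous H.curry.continuous) 2 two_pos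
  obtain ⟨m, hm⟩ := exists_nat_one_div_lt hδ
  let t : Fin (m + 1 + 1) → I := fun i =>
    ⟨(i : ℕ) / (m + 1 : ℝ), by positivity, by
      rw [div_le_one (by positivity)]
      exact_mod_cast Nat.le_of_lt_succ i.2⟩
  have hne (i : Fin (m + 1)) (p : T) : (H.curry (t i.castSucc) p : EuclideanSpace ℝ (Fin n)) +
      H.curry (t i.succ) p ≠ 0 := by
    refine add_ne_zero_of_dist_lt_two ((ContinuousMap.dist_apply_le_dist p).trans_lt (hH ?_))
    rw [Subtype.dist_eq, Real.dist_eq, abs_sub_comm]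
    convert! hm using 1
    simp only [t, Fin.val_succ, Fin.val_castSucc, Nat.cast_add, Nat.cast_one]
    rw [← sub_div, add_sub_cancel_left, abs_of_pos (by positivity)]
  choose α hα using fun i => exists_isNegReflection _ _ (hne i)
  refine ⟨m + 1, t, α, ?_, ?_, ?_, fun i => ⟨hα i, (hα i).rowOf_vecMul⟩⟩
  · ext; simp [t]
  · ext
    have : (m + 1 : ℝ) ≠ 0 := by positivity
    simp [t, this]
  · intro i j hij
    change ((i : ℕ) : ℝ) / (m + 1) ≤ ((j : ℕ) : ℝ) / (m + 1)
    gcongr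
    exact hij

theorem HasReflectionChain.gLEquiv {f g : C(T, UnitSphere n)} {H : f.Homotopy g}
    (h : HasReflectionChain H) : GLEquiv (rowOf f) (rowOf g) := by
  obtain ⟨N, t, α, h0, h1, -, hα⟩ := h
  have key (i : Fin (N + 1)) : GLEquiv (rowOf f) (rowOf (H.curry (t i))) := by
    induction i using Fin.induction with
    | zero =>
      have : H.curry (t 0) = f := by ext1 p; simp [h0]
      rw [this]
      exact .refl (isUnimodular_rowOf f)
    | succ i ih =>
      exact ih.trans ⟨isUnimodular_rowOf _, isUnimodular_rowOf _, α i, (hα i).2⟩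
  have : H.curry (t (Fin.last N)) = g := by ext1 p; simp [h1]
  simpa only [this] using key (Fin.last N)

/-! ### Completions, tangent fields and contractibility -/

theorem rowOf_const_basePoint :
    rowOf (ContinuousMap.const T basePoint) = Pi.single 0 1 := by
  ext i p
  by_cases hi : i = 0 <;> simp [rowOf, basePoint, hi]

theorem gLEquiv_single_xyz
    (H : (ContinuousMap.const (UnitSphere 3) basePoint).Homotopy (ContinuousMap.id _)) :
    GLEquiv (Pi.single 0 1) xyz := by
  rw [← rowOf_const_basePoint]
  exact (hasReflectionChain H).gLEquiv

theorem IsCompletable.hasNonvanishingTangentField (h : IsCompletable xyz) :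
    HasNonvanishingTangentField := by
  obtain ⟨α, hα⟩ := h
  let M : Matrix (Fin 3) (Fin 3) C(UnitSphere 3, ℝ) := α
  let r : UnitSphere 3 → EuclideanSpace ℝ (Fin 3) := fun p => WithLp.toLp 2 fun j => M 1 j p
  have hr : Continuous r := (PiLp.continuous_toLp 2 _).comp (by fun_prop)
  -- Where this projection vanishes, the second row is a multiple of the first, so the determinant
  -- is zero.
  refine ⟨⟨fun p => r p - inner ℝ p.1 (r p) • p.1, by fun_prop⟩, fun p => ⟨?_, fun h0 => ?_⟩⟩
  · rw [ContinuousMap.coe_mk, inner_sub_right, inner_smul_right, real_inner_self_eq_norm_sq,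
      norm_eq_of_mem_sphere]
    ring
  · have hdet : IsUnit ((M.map fun a => a p).det) := by
      have := (Matrix.isUnits_det_units α).map
        ((Pi.evalRingHom (fun _ : UnitSphere 3 => ℝ) p).comp ContinuousMap.coeFnRingHom)
      rwa [RingHom.map_det] at this
    have h01 (j : Fin 3) : M 1 j p = inner ℝ p.1 (r p) * M 0 j p := by
      have := congrFun (congrArg WithLp.ofLp (sub_eq_zero.1 h0)) j
      have h0j : M 0 j p = p.1 j := by
        simp only [M, hα]; rfl
      rw [h0j]
      exact this
    refine hdet.ne_zero ?_
    rw [Matrix.det_fin_three]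
    simp only [Matrix.map_apply, h01]
    ring

theorem isCompletable_xyz_of_contractibleSpace [ContractibleSpace (UnitSphere 3)] :
    IsCompletable xyz := by
  obtain ⟨q, ⟨K⟩⟩ := id_nullhomotopic (UnitSphere 3)
  -- The contraction may end at any point `q`; a path moves it to `basePoint`.
  obtain ⟨γ⟩ := PathConnectedSpace.joined basePoint q
  let H : (ContinuousMap.const (UnitSphere 3) basePoint).Homotopy (ContinuousMap.const _ q) :=
    { toFun := fun x => γ x.1
      map_zero_left := by simp
      map_one_left := by simp }
  exact (gLEquiv_single_xyz (H.trans K.symm)).isCompletable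

end SphereRows

end

theorem mainTheorem9 :
    -- homotopic maps into a sphere: a chain of equivalences through reflections
    (∀ (T : Type*) [TopologicalSpace T] [CompactSpace T] [T2Space T] (n : ℕ)
      (f g : C(T, SphereRows.UnitSphere n)) (H : f.Homotopy g),
      SphereRows.HasReflectionChain H ∧
        SphereRows.GLEquiv (SphereRows.rowOf f) (SphereRows.rowOf g)) ∧
    -- in particular, a contraction would give such a chain from (1, 0, 0) to (x, y, z)
    (∀ H : (ContinuousMap.const (SphereRows.UnitSphere 3) SphereRows.basePoint).Homotopy
        (ContinuousMap.id (SphereRows.UnitSphere 3)),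
      SphereRows.HasReflectionChain H ∧
        SphereRows.GLEquiv ![1, 0, 0] SphereRows.xyz ∧
        SphereRows.IsCompletable SphereRows.xyz) ∧
    -- from vector fields to completions, and from completions to contractibility
    (¬ SphereRows.HasNonvanishingTangentField →
      ¬ SphereRows.IsCompletable SphereRows.xyz) ∧
    (¬ SphereRows.IsCompletable SphereRows.xyz →
      ¬ ContractibleSpace (SphereRows.UnitSphere 3)) ∧
    -- the unconditional conclusions
    ¬ SphereRows.IsCompletable SphereRows.xyz ∧
    ¬ ContractibleSpace (SphereRows.UnitSphere 3) := by
  have hfield : ¬ SphereRows.HasNonvanishingTangentField →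
      ¬ SphereRows.IsCompletable SphereRows.xyz :=
    mt SphereRows.IsCompletable.hasNonvanishingTangentField
  have hcontr : ¬ SphereRows.IsCompletable SphereRows.xyz →
      ¬ ContractibleSpace (SphereRows.UnitSphere 3) :=
    mt fun _ => SphereRows.isCompletable_xyz_of_contractibleSpace
  have hxyz := hfield SphereRows.not_hasNonvanishingTangentField
  refine ⟨fun T _ _ _ n f g H => ⟨SphereRows.hasReflectionChain H,
    (SphereRows.hasReflectionChain H).gLEquiv⟩, fun H => ⟨SphereRows.hasReflectionChain H, ?_,
    (SphereRows.gLEquiv_single_xyz H).isCompletable⟩, hfield, hcontr, hxyz, hcontr hxyz⟩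
  have hrow : (![1, 0, 0] : Fin 3 → C(SphereRows.UnitSphere 3, ℝ)) = Pi.single 0 1 := by
    ext i
    fin_cases i <;> simp
  rw [hrow]
  exact SphereRows.gLEquiv_single_xyz H
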